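/- Let $p$ be a prime. Put $E_p(x)=\exp(px)$ if $p\neq 2$ and $E_2(x)=\exp(4x)$, where $\exp$ is the $p$-adic exponential power series; $E_p$ converges on $\mathbb{Z}_p$. For $P\in\mathbb{Z}[x_1,\dots,x_{2n}]$ let $F_P(x_1,\dots,x_n)=P(x_1,\dots,x_n,E_p(x_1),\dots,E_p(x_n))$ for $x\in\mathbb{Z}_p^n$. Assume the $p$-adic Schanuel conjecture: for all $m\ge 1$ and all $t_1,\dots,t_m\in\mathbb{C}_p$ of valuation $v(t_i)>1/(p-1)$ (normalised by $v(p)=1$) that are linearly independent over $\mathbb{Q}$, the field $\mathbb{Q}(t_1,\dots,t_m,\exp(t_1),\dots,\exp(t_m))$ has transcendence degree at least $m$ over $\mathbb{Q}$. Let $n\ge 1$ and $P\in\mathbb{Z}[x_1,\dots,x_{2n}]$. Assume that $F_P$ has a zero in $\mathbb{Z}_p^n$ and that, for every zero $a=(a_1,\dots,a_n)\in\mathbb{Z}_p^n$ of $F_P$, the components $a_1,\dots,a_n$ are linearly independent over $\mathbb{Q}$. Then there exist $b\in\mathbb{Z}_p^n$ and polynomials $Q,Q_1,\dots,Q_n,S_1,\dots,S_n\in\mathbb{Z}[x_1,\dots,x_{2n}]$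 such that 1. $F_P(b)=0$; 2. $b$ is a non-singular zero of the system $(F_{Q_1},\dots,F_{Q_n})$, that is, $F_{Q_i}(b)=0$ for all $i$ and the differentials of $F_{Q_1},\dots,F_{Q_n}$ at $b$ are linearly independent over $\mathbb{Q}_p$ (equivalently, the Jacobian determinant $\det\left(\partial F_{Q_i}/\partial x_j\right)(b)$ is nonzero); 3. $F_Q(b)\neq 0$; 4. $QP=\sum_{i=1}^n Q_iS_i$ in $\mathbb{Z}[x_1,\dots,x_{2n}]$. -/

import Mathlib

namespace PadicExp

/-- The `p`-adic Schanuel conjecture for the prime `p`: if `n ≥ 1` and `t₁, …, tₙ ∈ ℂ_p` are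
linearly independent over `ℚ` and lie in the domain of convergence of the exponential series, then
`ℚ(t₁, …, tₙ, exp t₁, …, exp tₙ)` has transcendence degree at least `n` over `ℚ`.
As `‖x‖ = p ^ (-v x)`, the bound on the norms says `v (t i) > 1 / (p - 1)`. -/
def SchanuelConjecture (p : ℕ) [Fact p.Prime] : Prop :=
  ∀ (n : ℕ) (_ : 1 ≤ n) (t : Fin n → ℂ_[p]),
    LinearIndependent ℚ t →
    (∀ i, ‖t i‖ < (p : ℝ) ^ (-(1 / ((p : ℝ) - 1)))) →
    (n : Cardinal) ≤ Algebra.trdeg ℚ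
      (IntermediateField.adjoin ℚ (Set.range t ∪ Set.range fun i => NormedSpace.exp (t i)))

/-- The factor in the exponent of the `p`-adic exponential: `p` for odd `p`, and `4` for `p = 2`. -/
def expFactor (p : ℕ) : ℕ := if p = 2 then 4 else p

/-- The exponential `E_p x = exp (p x)` (`exp (4 x)` if `p = 2`). The series converges for
`x ∈ ℤ_p`, and `E_p` is used only on the open subset `ℤ_p` of `ℚ_p`. -/
noncomputable def E (p : ℕ) [Fact p.Prime] (x : ℚ_[p]) : ℚ_[p] :=
  NormedSpace.exp ((expFactor p : ℚ_[p]) * x)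

/-- The exponential polynomial function
`F_P (x₁, …, xₙ) = P (x₁, …, xₙ, E_p x₁, …, E_p xₙ)` of a polynomial `P` over `ℤ` in `2n` variables:
the first `n` variables are the `Sum.inl i`, the last `n` variables are the `Sum.inr i`. -/
noncomputable def F (p : ℕ) [Fact p.Prime] {n : ℕ} (P : MvPolynomial (Fin n ⊕ Fin n) ℤ)
    (x : Fin n → ℚ_[p]) : ℚ_[p] :=
  MvPolynomial.aeval (Sum.elim x fun i => E p (x i)) P

/-- `b` is a non-singular zero of the system `G = (G₁, …, Gₘ)`: it is a common zero, and the
differentials of the `Gᵢ` at `b` are linearly independent over `ℚ_p` (for `m = n` this says that the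
Jacobian determinant of `G` at `b` is nonzero). -/
def IsNonsingularZero (p : ℕ) [Fact p.Prime] {n m : ℕ}
    (G : Fin m → (Fin n → ℚ_[p]) → ℚ_[p]) (b : Fin n → ℚ_[p]) : Prop :=
  (∀ i, G i b = 0) ∧ LinearIndependent ℚ_[p] fun i => fderiv ℚ_[p] (G i) b

end PadicExp

/-! The proof moves from the given zero to one cut out by a square system, then turns Schanuel's
conjecture into a Jacobian criterion there.

Moving the zero (`exists_zero_nonsingular`). Consider all exponential polynomials vanishing at the
given zero `a`. Choose among them `G i`, `i ∈ S`, whose differentials at `a` form a basis of the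
span of all their differentials, and complete these by coordinates `x_k` to a local chart. Partial
derivatives of exponential polynomials are exponential polynomials, so differentiating a member of
the family along the slice `G i = 0` (`i ∈ S`), and clearing the Jacobian determinant, gives an
exponential polynomial again. It vanishes at `a` by the choice of `S`. Hence every member vanishes
to infinite order along the slice, and by analyticity `F_P` is zero on the slice near `a`. As `ℤ` is
dense in `ℤ_p`, some point `b` of the slice has integers `c i` as its remaining coordinates; the `G
i` (`i ∈ S`) and `G i - c i` (`i ∉ S`) have a nonsingular zero at `b`.

Generating the ideal (`exists_mul_eq_sum_of_le_trdeg`). By multilinearity of the determinant, the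
nonzero functional determinant yields a nonzero `n × n` minor of the algebraic Jacobian, using one
of `x_j`, `y_j` for each `j`. Schanuel at `b` gives transcendence degree at least `n`, so the `n`
remaining coordinates of `(b, E_p b)` are algebraically independent. The local ring at `(b, E_p b)`
modulo the system is then unramified over the rational function field in these coordinates, hence a
field. So `P` is zero in it, and clearing denominators gives `Q`. -/

open scoped Topology

namespace PadicExp

/-! ### Convergence and derivative of the `p`-adic exponential. -/

section Exponential

variable {p : ℕ} [hp : Fact p.Prime]

/-- Legendre's formula: `(p - 1) v(n!)` is `n` minus the digit sum of `n` in base `p`, hence at most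
`n`. -/
theorem norm_inv_factorial_mul_pow_le (n : ℕ) :
    ‖((n.factorial : ℚ_[p]))⁻¹‖ * ((p : ℝ) ^ (-(1 / ((p : ℝ) - 1)))) ^ n ≤ 1 := by
  have hp1 : (1 : ℝ) < p := by exact_mod_cast hp.out.one_lt
  have hp0 : (0 : ℝ) < p := by linarith
  have hv := sub_one_mul_padicValNat_factorial (p := p) n
  have hv' : ((p : ℝ) - 1) * padicValNat p n.factorial ≤ n := by
    have h : (p - 1) * padicValNat p n.factorial ≤ n := hv ▸ Nat.sub_le _ _
    have h2 : (((p - 1 : ℕ) : ℝ)) * (padicValNat p n.factorial : ℝ) ≤ n := by exact_mod_cast h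
    rwa [Nat.cast_sub hp.out.one_lt.le, Nat.cast_one] at h2
  have hnorm : ‖((n.factorial : ℚ_[p]))⁻¹‖ = (p : ℝ) ^ ((padicValNat p n.factorial : ℕ) : ℝ) := by
    rw [norm_inv, Padic.norm_eq_zpow_neg_valuation (by exact_mod_cast n.factorial_ne_zero),
      Padic.valuation_natCast, zpow_neg, inv_inv, zpow_natCast, Real.rpow_natCast]
  rw [hnorm, ← Real.rpow_natCast ((p : ℝ) ^ _) n, ← Real.rpow_mul hp0.le, ← Real.rpow_add hp0]
  apply Real.rpow_le_one_of_one_le_of_nonpos hp1.le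
  have h1 : (padicValNat p n.factorial : ℝ) ≤ n / ((p : ℝ) - 1) := by
    rw [le_div_iff₀ (by linarith)]; linarith
  have : -(1 / ((p : ℝ) - 1)) * n = -(n / ((p : ℝ) - 1)) := by ring
  linarith

theorem le_radius_expSeries :
    (((p : NNReal) ^ (-(1 / ((p : ℝ) - 1))) : NNReal) : ENNReal) ≤
      (NormedSpace.expSeries ℚ_[p] ℚ_[p]).radius := by
  apply FormalMultilinearSeries.le_radius_of_bound _ 1
  intro n
  refine le_trans (le_of_eq ?_) (norm_inv_factorial_mul_pow_le (p := p) n)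
  rw [NormedSpace.expSeries, norm_smul, ContinuousMultilinearMap.norm_mkPiAlgebraFin, mul_one]
  simp

/-- For odd `p` this is `1 / (p - 1) < 1`. For `p = 2` the bound is `1/2`, which `‖2‖` only equals;
hence the factor `4`. -/
theorem norm_expFactor_lt : ‖(expFactor p : ℚ_[p])‖ < (p : ℝ) ^ (-(1 / ((p : ℝ) - 1))) := by
  have hp1 : (1 : ℝ) < p := by exact_mod_cast hp.out.one_lt
  unfold expFactor
  split_ifs with h
  · subst h
    have : ((4 : ℕ) : ℚ_[2]) = ((2 : ℕ) : ℚ_[2]) ^ 2 := by norm_num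
    rw [this, norm_pow, Padic.norm_p]
    norm_num
  · have h3 : (2 : ℝ) < p := by exact_mod_cast lt_of_le_of_ne hp.out.two_le (Ne.symm h)
    rw [Padic.norm_p, ← Real.rpow_neg_one]
    apply Real.rpow_lt_rpow_of_exponent_lt hp1
    rw [neg_lt_neg_iff, div_lt_one] <;> linarith

theorem expFactor_ne_zero : (expFactor p : ℚ_[p]) ≠ 0 := by
  have : expFactor p ≠ 0 := by
    unfold expFactor
    split_ifs
    · norm_num
    · exact hp.out.ne_zero
  exact_mod_cast this

theorem norm_expFactor_mul_lt {x : ℚ_[p]} (hx : ‖x‖ ≤ 1) :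
    ‖(expFactor p : ℚ_[p]) * x‖ < (p : ℝ) ^ (-(1 / ((p : ℝ) - 1))) := by
  rw [norm_mul]
  exact (mul_le_of_le_one_right (norm_nonneg _) hx).trans_lt norm_expFactor_lt

theorem expFactor_mul_mem_eball {x : ℚ_[p]} (hx : ‖x‖ ≤ 1) :
    (expFactor p : ℚ_[p]) * x ∈
      Metric.eball (0 : ℚ_[p]) (NormedSpace.expSeries ℚ_[p] ℚ_[p]).radius := by
  rw [Metric.mem_eball, edist_zero_right]
  refine lt_of_lt_of_le ?_ le_radius_expSeries
  rw [enorm_eq_nnnorm, ENNReal.coe_lt_coe, ← NNReal.coe_lt_coe]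
  simpa using norm_expFactor_mul_lt hx

theorem analyticAt_E {x : ℚ_[p]} (hx : ‖x‖ ≤ 1) : AnalyticAt ℚ_[p] (E p) x := by
  have h := NormedSpace.analyticAt_exp_of_mem_ball (𝕂 := ℚ_[p]) _ (expFactor_mul_mem_eball hx)
  exact h.fun_comp (f := fun x => (expFactor p : ℚ_[p]) * x) (by fun_prop)

theorem hasDerivAt_E {x : ℚ_[p]} (hx : ‖x‖ ≤ 1) :
    HasDerivAt (E p) ((expFactor p : ℚ_[p]) * E p x) x := by
  have h := hasDerivAt_exp_of_mem_ball (expFactor_mul_mem_eball hx)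
  have h2 : HasDerivAt (fun x : ℚ_[p] => (expFactor p : ℚ_[p]) * x) (expFactor p : ℚ_[p]) x := by
    simpa using (hasDerivAt_id x).const_mul (expFactor p : ℚ_[p])
  rw [mul_comm]
  exact h.comp x h2

/-- Links `E p`, defined over `ℚ_p`, with the exponential of `ℂ_p` in Schanuel's conjecture: a
continuous homomorphism commutes with the series. -/
theorem algebraMap_E {x : ℚ_[p]} (hx : ‖x‖ ≤ 1) :
    algebraMap ℚ_[p] ℂ_[p] (E p x) =
      NormedSpace.exp (algebraMap ℚ_[p] ℂ_[p] ((expFactor p : ℚ_[p]) * x)) :=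
  NormedSpace.map_exp_of_mem_ball (𝕂 := ℚ_[p]) (algebraMap ℚ_[p] ℂ_[p])
    (algebraMapCLM ℚ_[p] ℂ_[p]).continuous _ (expFactor_mul_mem_eball hx)

end Exponential

/-! ### Exponential polynomials and their Jacobians. -/

section ExponentialPolynomials

variable {p n : ℕ}

open MvPolynomial

/-- The derivation of `ℤ[x, y]` corresponding to `∂/∂xⱼ` under the substitution `y = E_p x`. -/
noncomputable def expDeriv (p : ℕ) {n : ℕ} (j : Fin n) :
    Derivation ℤ (MvPolynomial (Fin n ⊕ Fin n) ℤ) (MvPolynomial (Fin n ⊕ Fin n) ℤ) :=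
  pderiv (R := ℤ) (Sum.inl j) +
    (C (expFactor p : ℤ) * X (Sum.inr j) : MvPolynomial (Fin n ⊕ Fin n) ℤ) •
      pderiv (R := ℤ) (Sum.inr j)

theorem expDeriv_X_inl (i j : Fin n) :
    expDeriv p j (X (Sum.inl i)) = if i = j then 1 else 0 := by
  simp [expDeriv, pderiv_X, Pi.single_apply]

theorem expDeriv_X_inr (i j : Fin n) :
    expDeriv p j (X (Sum.inr i)) =
      if i = j then C (expFactor p : ℤ) * X (Sum.inr i) else 0 := by
  simp +contextual [expDeriv, pderiv_X, Pi.single_apply]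

variable [hp : Fact p.Prime]

/-- Evaluation of exponential polynomials at a point, as a ring homomorphism. -/
noncomputable def evalF (p : ℕ) [Fact p.Prime] {n : ℕ} (x : Fin n → ℚ_[p]) :
    MvPolynomial (Fin n ⊕ Fin n) ℤ →ₐ[ℤ] ℚ_[p] :=
  aeval (Sum.elim x fun i => E p (x i))

theorem evalF_apply (x : Fin n → ℚ_[p]) (R : MvPolynomial (Fin n ⊕ Fin n) ℤ) :
    evalF p x R = F p R x := rfl

theorem F_C (a : ℤ) : F p (C a : MvPolynomial (Fin n ⊕ Fin n) ℤ) = fun _ => (a : ℚ_[p]) := by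
  ext; simp [F]

theorem F_add (P Q : MvPolynomial (Fin n ⊕ Fin n) ℤ) : F p (P + Q) = F p P + F p Q := by
  ext; simp [F]

theorem F_mul (P Q : MvPolynomial (Fin n ⊕ Fin n) ℤ) : F p (P * Q) = F p P * F p Q := by
  ext; simp [F]

theorem F_X_inl (i : Fin n) :
    F p (X (Sum.inl i) : MvPolynomial (Fin n ⊕ Fin n) ℤ) = fun x => x i := by
  ext; simp [F]

theorem F_X_inr (i : Fin n) :
    F p (X (Sum.inr i) : MvPolynomial (Fin n ⊕ Fin n) ℤ) = fun x => E p (x i) := by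
  ext; simp [F]

theorem analyticAt_F (R : MvPolynomial (Fin n ⊕ Fin n) ℤ) {x : Fin n → ℚ_[p]}
    (hx : ∀ i, ‖x i‖ ≤ 1) : AnalyticAt ℚ_[p] (F p R) x := by
  have hproj (i : Fin n) : AnalyticAt ℚ_[p] (fun y : Fin n → ℚ_[p] => y i) x :=
    (ContinuousLinearMap.proj (R := ℚ_[p]) (φ := fun _ : Fin n => ℚ_[p]) i).analyticAt x
  induction R using MvPolynomial.induction_on with
  | C a => rw [F_C]; exact analyticAt_const
  | add P Q hP hQ => rw [F_add]; exact hP.add hQ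
  | mul_X P i hP =>
    rw [F_mul]
    refine hP.mul ?_
    cases i with
    | inl i => rw [F_X_inl]; exact hproj i
    | inr i =>
      rw [F_X_inr]
      exact (analyticAt_E (hx i)).fun_comp_of_eq (f := fun y : Fin n → ℚ_[p] => y i) (hproj i) rfl

/-- Exponential polynomials are closed under partial differentiation because `E_p' = expFactor p ·
E_p`; both sides obey the Leibniz rule, so the variables decide. -/
theorem hasFDerivAt_F (R : MvPolynomial (Fin n ⊕ Fin n) ℤ) {x : Fin n → ℚ_[p]}
    (hx : ∀ i, ‖x i‖ ≤ 1) :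
    HasFDerivAt (F p R) (∑ j, F p (expDeriv p j R) x •
      (ContinuousLinearMap.proj j : (Fin n → ℚ_[p]) →L[ℚ_[p]] ℚ_[p])) x := by
  have hproj (i : Fin n) : HasFDerivAt (fun y : Fin n → ℚ_[p] => y i)
    (ContinuousLinearMap.proj i : (Fin n → ℚ_[p]) →L[ℚ_[p]] ℚ_[p]) x :=
    (ContinuousLinearMap.proj (R := ℚ_[p]) (φ := fun _ : Fin n => ℚ_[p]) i).hasFDerivAt
  induction R using MvPolynomial.induction_on with
  | C a =>
    rw [F_C]
    refine (hasFDerivAt_const (a : ℚ_[p]) x).congr_fderiv ?_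
    ext v
    simp [F]
  | add P Q hP hQ =>
    rw [F_add]
    refine (hP.add hQ).congr_fderiv ?_
    ext v
    simp [F, add_mul, Finset.sum_add_distrib]
  | mul_X P i hP =>
    have hi : HasFDerivAt (F p (X i : MvPolynomial (Fin n ⊕ Fin n) ℤ))
        (∑ j, F p (expDeriv p j (X i)) x •
          (ContinuousLinearMap.proj j : (Fin n → ℚ_[p]) →L[ℚ_[p]] ℚ_[p])) x := by
      cases i with
      | inl i =>
        rw [F_X_inl]
        refine (hproj i).congr_fderiv ?_
        ext v
        simp only [expDeriv_X_inl, sum_apply, smul_apply, ContinuousLinearMap.proj_apply, smul_eq_mul]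
        simp [F, apply_ite (aeval (R := ℤ) (Sum.elim x fun i => E p (x i)))]
      | inr i =>
        rw [F_X_inr]
        refine (HasDerivAt.comp_hasFDerivAt x (hasDerivAt_E (hx i)) (hproj i)).congr_fderiv ?_
        ext v
        simp only [expDeriv_X_inr, sum_apply, smul_apply, ContinuousLinearMap.proj_apply, smul_eq_mul]
        simp [F, apply_ite (aeval (R := ℤ) (Sum.elim x fun i => E p (x i)))]
    rw [F_mul]
    refine (hP.mul hi).congr_fderiv ?_
    ext v
    simp only [Derivation.leibniz, smul_eq_mul, F_add, F_mul, Pi.add_apply, Pi.mul_apply,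
      add_apply, smul_apply, sum_apply, Finset.mul_sum, ← Finset.sum_add_distrib]
    exact Finset.sum_congr rfl fun j _ => by ring

theorem fderiv_F_apply (R : MvPolynomial (Fin n ⊕ Fin n) ℤ) {x : Fin n → ℚ_[p]}
    (hx : ∀ i, ‖x i‖ ≤ 1) (v : Fin n → ℚ_[p]) :
    fderiv ℚ_[p] (F p R) x v = ∑ j, F p (expDeriv p j R) x * v j := by
  rw [(hasFDerivAt_F R hx).fderiv]
  simp

/-- The Jacobian matrix of a system of exponential polynomials, as a matrix of polynomials. -/
noncomputable def jacobian (p : ℕ) {n m : ℕ} (G : Fin m → MvPolynomial (Fin n ⊕ Fin n) ℤ) :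
    Matrix (Fin m) (Fin n) (MvPolynomial (Fin n ⊕ Fin n) ℤ) :=
  Matrix.of fun i j => expDeriv p j (G i)

theorem linearIndependent_fderiv_F_iff (G : Fin n → MvPolynomial (Fin n ⊕ Fin n) ℤ)
    {x : Fin n → ℚ_[p]} (hx : ∀ i, ‖x i‖ ≤ 1) :
    LinearIndependent ℚ_[p] (fun i => fderiv ℚ_[p] (F p (G i)) x) ↔
      F p (jacobian p G).det x ≠ 0 := by
  -- Coordinates on the dual space, in which the differentials become the rows of the Jacobian
  -- matrix.
  let T : ((Fin n → ℚ_[p]) →L[ℚ_[p]] ℚ_[p]) →ₗ[ℚ_[p]] (Fin n → ℚ_[p]) :=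
    { toFun := fun f j => f (Pi.single j 1)
      map_add' := fun f g => by ext; simp
      map_smul' := fun c f => by ext; simp }
  have hT : LinearMap.ker T = ⊥ := by
    rw [LinearMap.ker_eq_bot']
    intro f hf
    refine ContinuousLinearMap.coe_injective (LinearMap.pi_ext' fun j => LinearMap.ext_ring ?_)
    simpa [T] using congrFun hf j
  rw [← T.linearIndependent_iff hT]
  have h : (T ∘ fun i => fderiv ℚ_[p] (F p (G i)) x) =
      ((evalF p x).toRingHom.mapMatrix (jacobian p G)).row := by
    ext i j
    simp only [T, Function.comp_apply, LinearMap.coe_mk, AddHom.coe_mk, fderiv_F_apply _ hx]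
    simp [jacobian, Matrix.row, Pi.single_apply, evalF_apply]
  rw [h, Matrix.linearIndependent_rows_iff_isUnit, Matrix.isUnit_iff_isUnit_det, ← RingHom.map_det,
    isUnit_iff_ne_zero]
  rfl

end ExponentialPolynomials

end PadicExp

/-! ### Analytic functions: vanishing on lines and order of vanishing. -/

section AnalyticGeneralities

variable {𝕜 : Type*} [NontriviallyNormedField 𝕜]

/-- An analytic function that vanishes near the centre of its ball of convergence along a line
vanishes along the whole intersection of that line and the ball. -/
theorem HasFPowerSeriesOnBall.eq_zero_of_eventually_eq_zero_on_line
    {E F : Type*} [NormedAddCommGroup E] [NormedSpace 𝕜 E] [NormedAddCommGroup F] [NormedSpace 𝕜 F]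
    {f : E → F} {q : FormalMultilinearSeries 𝕜 E F} {x : E} {r : ENNReal}
    (hf : HasFPowerSeriesOnBall f q x r) {w : E} (hw : w ∈ Metric.eball (0 : E) r)
    (h : ∀ᶠ t : 𝕜 in 𝓝 0, f (x + t • w) = 0) : f (x + w) = 0 := by
  -- The Taylor series of `t ↦ f (x + t • w)` at `0`. It is zero by uniqueness, and the terms of `q`
  -- at `w` are its coefficients.
  let c : FormalMultilinearSeries 𝕜 𝕜 F := fun n =>
    ContinuousMultilinearMap.mkPiRing 𝕜 (Fin n) (q n fun _ => w)
  have hcoeff (n : ℕ) : c.coeff n = q n fun _ => w := by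
    simp [c, FormalMultilinearSeries.coeff]
  have hball : ∀ᶠ t : 𝕜 in 𝓝 0, t • w ∈ Metric.eball (0 : E) r := by
    have : Filter.Tendsto (fun t : 𝕜 => t • w) (𝓝 0) (𝓝 0) := by
      have h0 : ContinuousAt (fun t : 𝕜 => t • w) 0 := by fun_prop
      simpa [ContinuousAt] using h0
    exact this (Metric.eball_mem_nhds _ hf.r_pos)
  have hc : HasFPowerSeriesAt (0 : 𝕜 → F) c 0 := by
    rw [hasFPowerSeriesAt_iff]
    filter_upwards [h, hball] with t ht htw
    have := hf.hasSum htw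
    rw [ht] at this
    change HasSum _ 0
    convert this using 2 with n
    rw [hcoeff, ContinuousMultilinearMap.map_smul_univ]
    simp
  have hc0 := hc.eq_zero
  have hterm (n : ℕ) : (q n fun _ => w) = 0 := by
    rw [← hcoeff, hc0]
    simp [FormalMultilinearSeries.coeff]
  have := hf.hasSum hw
  simp only [hterm] at this
  exact this.unique hasSum_zero

theorem le_analyticOrderAt_sum {ι E : Type*} [NormedAddCommGroup E] [NormedSpace 𝕜 E]
    (s : Finset ι) {f : ι → 𝕜 → E} {z : 𝕜} {N : ℕ∞}
    (h : ∀ i ∈ s, N ≤ analyticOrderAt (f i) z) : N ≤ analyticOrderAt (∑ i ∈ s, f i) z := by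
  classical
  induction s using Finset.induction_on with
  | empty =>
    have : analyticOrderAt (∑ i ∈ (∅ : Finset ι), f i) z = ⊤ := by
      rw [analyticOrderAt_eq_top]
      simp
    exact this ▸ le_top
  | insert a s ha ih =>
    rw [Finset.sum_insert ha]
    exact (le_min (h a (Finset.mem_insert_self a s))
      (ih fun i hi => h i (Finset.mem_insert_of_mem hi))).trans le_analyticOrderAt_add

/-- Only an inequality, as `c = 0` raises the order to `⊤`. -/
theorem le_analyticOrderAt_const_mul {f : 𝕜 → 𝕜} {z : 𝕜} (hf : AnalyticAt 𝕜 f z) (c : 𝕜) :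
    analyticOrderAt f z ≤ analyticOrderAt (fun t => c * f t) z := by
  have h := analyticOrderAt_mul (f := fun _ => c) analyticAt_const hf
  exact le_add_self.trans h.ge

/-- Let `I` be a family of functions that are analytic at `z` and vanish at `z`. If the derivative
of each of them is, up to a factor that does not vanish at `z`, a linear combination of members of
`I`, then all members of `I` vanish near `z`. -/
theorem eventually_eq_zero_of_deriv_mem_span [CompleteSpace 𝕜] [CharZero 𝕜] {z : 𝕜}
    {I : Set (𝕜 → 𝕜)} (han : ∀ f ∈ I, AnalyticAt 𝕜 f z) (hz : ∀ f ∈ I, f z = 0)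
    {δ : 𝕜 → 𝕜} (hδ : AnalyticAt 𝕜 δ z) (hδz : δ z ≠ 0)
    (hderiv : ∀ f ∈ I, ∃ (ι : Type) (s : Finset ι) (c : ι → 𝕜) (g : ι → 𝕜 → 𝕜),
      (∀ i ∈ s, g i ∈ I) ∧ ∀ᶠ t in 𝓝 z, δ t * deriv f t = ∑ i ∈ s, c i * g i t)
    {f : 𝕜 → 𝕜} (hf : f ∈ I) : ∀ᶠ t in 𝓝 z, f t = 0 := by
  rw [← analyticOrderAt_eq_top, ENat.eq_top_iff_forall_ge]
  intro N
  induction N generalizing f with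
  | zero => simp
  | succ N ih =>
    -- In characteristic zero, differentiating a function that vanishes at `z` lowers its order by
    -- exactly one, and the factor `δ` does not change the order. So a bound `N` valid for all of
    -- `I` improves to `N + 1`.
    rw [Nat.cast_add, Nat.cast_one, ← analyticOrderAt_deriv_ge_iff (han f hf) (hz f hf)]
    have hmul := analyticOrderAt_mul hδ (han f hf).deriv
    rw [hδ.analyticOrderAt_eq_zero.mpr hδz, zero_add] at hmul
    rw [← hmul]
    obtain ⟨ι, s, c, g, hg, heq⟩ := hderiv f hf
    have heq' : δ * deriv f =ᶠ[𝓝 z] ∑ i ∈ s, fun t => c i * g i t := by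
      filter_upwards [heq] with t ht
      simpa using ht
    rw [analyticOrderAt_congr heq']
    exact le_analyticOrderAt_sum s fun i hi =>
      (ih (hg i hi)).trans (le_analyticOrderAt_const_mul (han _ (hg i hi)) (c i))

end AnalyticGeneralities

/-- Let `U` span a vector space of dimension `n`. A basis of the span of a set `T`, taken from `T`,
can be completed to a basis of the whole space by members of `U`. -/
theorem exists_linearIndependent_mem_or_mem {K V : Type*} [Field K] [AddCommGroup V] [Module K V]
    {n : ℕ} [FiniteDimensional K V] (hn : Module.finrank K V = n) (T U : Set V)
    (hU : Submodule.span K U = ⊤) :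
    ∃ (e : Fin n → V) (S : Set (Fin n)), LinearIndependent K e ∧ (∀ i ∈ S, e i ∈ T) ∧
      (∀ i ∉ S, e i ∈ U) ∧ T ⊆ Submodule.span K (e '' S) := by
  obtain ⟨b₁, hb₁T, hb₁span, hb₁⟩ := exists_linearIndependent K T
  obtain ⟨b, hb, hb₁b, hspan, hind⟩ := exists_linearIndepOn_id_extension
    (s := b₁) (t := b₁ ∪ U) hb₁ Set.subset_union_left
  have hind' : LinearIndependent K ((↑) : b → V) := hind
  have htop : ⊤ ≤ Submodule.span K (Set.range ((↑) : b → V)) := by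
    rw [Subtype.range_coe, ← hU]
    exact Submodule.span_le.mpr (Set.subset_union_right.trans hspan)
  let B := Module.Basis.mk hind' htop
  have : Fintype b := FiniteDimensional.fintypeBasisIndex B
  have hcard : Fintype.card b = n := by rw [← hn, Module.finrank_eq_card_basis B]
  let φ : Fin n ≃ b := (Fintype.equivFinOfCardEq hcard).symm
  refine ⟨fun i => φ i, {i | (φ i : V) ∈ b₁}, hind'.comp φ φ.injective, fun i hi => hb₁T hi,
    fun i hi => (hb (φ i).2).resolve_left hi, ?_⟩
  have himage : (fun i => (φ i : V)) '' {i | (φ i : V) ∈ b₁} = b₁ := by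
    ext v
    constructor
    · rintro ⟨i, hi, rfl⟩
      exact hi
    · intro hv
      exact ⟨φ.symm ⟨v, hb₁b hv⟩, by simpa using hv, by simp⟩
  rw [himage, hb₁span]
  exact Submodule.subset_span

namespace PadicExp

/-! ### Finding a zero of `F_P` that is a nonsingular zero of a square system. -/

section NonsingularSystem

variable {p n : ℕ} [hp : Fact p.Prime]

open MvPolynomial

theorem sum_F_expDeriv_mul_adjugate (G : Fin n → MvPolynomial (Fin n ⊕ Fin n) ℤ)
    (R : MvPolynomial (Fin n ⊕ Fin n) ℤ) (l : Fin n) (x : Fin n → ℚ_[p]) :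
    F p (∑ j, expDeriv p j R * (jacobian p G).adjugate j l) x =
      ∑ j, F p (expDeriv p j R) x * F p ((jacobian p G).adjugate j l) x := by
  simp [F]

theorem sum_F_adjugate_mul_jacobian (G : Fin n → MvPolynomial (Fin n ⊕ Fin n) ℤ)
    (j k : Fin n) (x : Fin n → ℚ_[p]) :
    ∑ l, F p ((jacobian p G).adjugate j l) x * F p (expDeriv p k (G l)) x =
      if j = k then F p (jacobian p G).det x else 0 := by
  have h := congrArg (fun M => evalF p x (M j k)) (Matrix.adjugate_mul (jacobian p G))
  simp only [Matrix.mul_apply, Matrix.smul_apply, Matrix.one_apply, map_sum, map_mul] at h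
  rw [show ∑ l, F p ((jacobian p G).adjugate j l) x * F p (expDeriv p k (G l)) x = _ from h]
  split_ifs <;> simp [evalF, F]

theorem sum_F_jacobian_mul_adjugate (G : Fin n → MvPolynomial (Fin n ⊕ Fin n) ℤ)
    (i l : Fin n) (x : Fin n → ℚ_[p]) :
    ∑ j, F p (expDeriv p j (G i)) x * F p ((jacobian p G).adjugate j l) x =
      if i = l then F p (jacobian p G).det x else 0 := by
  have h := congrArg (fun M => evalF p x (M i l)) (Matrix.mul_adjugate (jacobian p G))
  simp only [Matrix.mul_apply, Matrix.smul_apply, Matrix.one_apply, map_sum, map_mul] at h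
  rw [show ∑ j, F p (expDeriv p j (G i)) x * F p ((jacobian p G).adjugate j l) x = _ from h]
  split_ifs <;> simp [evalF, F]

/-- Cramer's rule: recovers a vector, up to the determinant, from the values of the differentials on
it. -/
theorem sum_F_adjugate_mul_sum_jacobian (G : Fin n → MvPolynomial (Fin n ⊕ Fin n) ℤ)
    (x v : Fin n → ℚ_[p]) (j : Fin n) :
    ∑ l, F p ((jacobian p G).adjugate j l) x * ∑ k, F p (expDeriv p k (G l)) x * v k =
      F p (jacobian p G).det x * v j := by
  simp_rw [Finset.mul_sum, ← mul_assoc]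
  rw [Finset.sum_comm]
  simp_rw [← Finset.sum_mul, sum_F_adjugate_mul_jacobian]
  simp

/-- At a point of `ℤ_pⁿ` there are local coordinates consisting of exponential polynomials that
vanish at the point, whose differentials span the differentials of all such exponential polynomials,
and of some of the standard coordinates. -/
theorem exists_adapted_coordinates {a : Fin n → ℚ_[p]} (ha : ∀ i, ‖a i‖ ≤ 1) :
    ∃ (G : Fin n → MvPolynomial (Fin n ⊕ Fin n) ℤ) (S : Set (Fin n)),
      F p (jacobian p G).det a ≠ 0 ∧ (∀ i ∈ S, F p (G i) a = 0) ∧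
      (∀ i ∉ S, ∃ k, G i = X (Sum.inl k)) ∧
      ∀ R, F p R a = 0 → fderiv ℚ_[p] (F p R) a ∈
        Submodule.span ℚ_[p] ((fun i => fderiv ℚ_[p] (F p (G i)) a) '' S) := by
  let T : Set ((Fin n → ℚ_[p]) →L[ℚ_[p]] ℚ_[p]) :=
    {φ | ∃ R, F p R a = 0 ∧ φ = fderiv ℚ_[p] (F p R) a}
  let U : Set ((Fin n → ℚ_[p]) →L[ℚ_[p]] ℚ_[p]) :=
    Set.range fun k => fderiv ℚ_[p] (F p (X (Sum.inl k))) a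
  have hU : Submodule.span ℚ_[p] U = ⊤ := by
    rw [eq_top_iff]
    intro φ _
    have : φ = ∑ k, φ (Pi.single k 1) • fderiv ℚ_[p] (F p (X (Sum.inl k))) a := by
      refine ContinuousLinearMap.coe_injective (LinearMap.pi_ext' fun j => LinearMap.ext_ring ?_)
      simp [fderiv_F_apply _ ha, expDeriv_X_inl, Pi.single_apply, F,
        apply_ite (aeval (R := ℤ) (Sum.elim a fun i => E p (a i)))]
    rw [this]
    exact Submodule.sum_mem _ fun k _ =>
      Submodule.smul_mem _ _ (Submodule.subset_span ⟨k, rfl⟩)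
  have hrank : Module.finrank ℚ_[p] ((Fin n → ℚ_[p]) →L[ℚ_[p]] ℚ_[p]) = n := by
    rw [← (LinearMap.toContinuousLinearMap (𝕜 := ℚ_[p]) (E := Fin n → ℚ_[p])
      (F' := ℚ_[p])).finrank_eq]
    simp
  obtain ⟨e, S, he, heT, heU, hspan⟩ := exists_linearIndependent_mem_or_mem hrank T U hU
  have hG (i : Fin n) : ∃ R : MvPolynomial (Fin n ⊕ Fin n) ℤ,
      e i = fderiv ℚ_[p] (F p R) a ∧ (i ∈ S → F p R a = 0) ∧
      (i ∉ S → ∃ k, R = X (Sum.inl k)) := by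
    by_cases hi : i ∈ S
    · obtain ⟨R, hR, h⟩ := heT i hi
      exact ⟨R, h, fun _ => hR, fun h => absurd hi h⟩
    · obtain ⟨k, h⟩ := heU i hi
      exact ⟨_, h.symm, fun h => absurd h hi, fun _ => ⟨k, rfl⟩⟩
  choose G hGe hGS hGX using hG
  obtain rfl : e = fun i => fderiv ℚ_[p] (F p (G i)) a := funext hGe
  exact ⟨G, S, (linearIndependent_fderiv_F_iff G ha).mp he, hGS, hGX,
    fun R hR => hspan ⟨R, hR, rfl⟩⟩

/-- The value is the differential of `F p R` applied to column `l` of the adjugate. That column is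
killed by the differential of every `G i` with `i ≠ l`, in particular for `i ∈ S`. -/
theorem F_tangential_eq_zero {a : Fin n → ℚ_[p]} (ha : ∀ i, ‖a i‖ ≤ 1)
    {G : Fin n → MvPolynomial (Fin n ⊕ Fin n) ℤ} {S : Set (Fin n)}
    {R : MvPolynomial (Fin n ⊕ Fin n) ℤ}
    (hR : fderiv ℚ_[p] (F p R) a ∈
      Submodule.span ℚ_[p] ((fun i => fderiv ℚ_[p] (F p (G i)) a) '' S))
    {l : Fin n} (hl : l ∉ S) :
    F p (∑ j, expDeriv p j R * (jacobian p G).adjugate j l) a = 0 := by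
  rw [sum_F_expDeriv_mul_adjugate,
    ← fderiv_F_apply R ha (fun j => F p ((jacobian p G).adjugate j l) a)]
  generalize fderiv ℚ_[p] (F p R) a = φ at hR ⊢
  induction hR using Submodule.span_induction with
  | mem φ h =>
    obtain ⟨i, hi, rfl⟩ := h
    simp only [fderiv_F_apply _ ha, sum_F_jacobian_mul_adjugate]
    rw [if_neg fun h : i = l => hl (h ▸ hi)]
  | zero => simp
  | add φ ψ _ _ h1 h2 => simp [h1, h2]
  | smul c φ _ h => simp [h]

/-- The local inverse of a system of exponential polynomials with nonvanishing Jacobian. -/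
theorem exists_analytic_local_inverse {a : Fin n → ℚ_[p]} (ha : ∀ i, ‖a i‖ ≤ 1)
    {G : Fin n → MvPolynomial (Fin n ⊕ Fin n) ℤ} (hG : F p (jacobian p G).det a ≠ 0) :
    ∃ Ψ : (Fin n → ℚ_[p]) → (Fin n → ℚ_[p]), AnalyticAt ℚ_[p] Ψ (fun i => F p (G i) a) ∧
      Ψ (fun i => F p (G i) a) = a ∧
      ∀ᶠ y in 𝓝 (fun i => F p (G i) a), (fun i => F p (G i) (Ψ y)) = y := by
  let Φ : (Fin n → ℚ_[p]) → (Fin n → ℚ_[p]) := fun x i => F p (G i) x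
  have hΦ : AnalyticAt ℚ_[p] Φ a := AnalyticAt.pi fun i => analyticAt_F (G i) ha
  let A : (Fin n → ℚ_[p]) →L[ℚ_[p]] (Fin n → ℚ_[p]) :=
    ContinuousLinearMap.pi fun i => fderiv ℚ_[p] (F p (G i)) a
  have hA : HasFDerivAt Φ A a :=
    hasFDerivAt_pi.mpr fun i => (analyticAt_F (G i) ha).differentiableAt.hasFDerivAt
  have hker : LinearMap.ker (A : (Fin n → ℚ_[p]) →ₗ[ℚ_[p]] (Fin n → ℚ_[p])) = ⊥ := by
    rw [LinearMap.ker_eq_bot']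
    intro v hv
    have hv' (i : Fin n) : ∑ k, F p (expDeriv p k (G i)) a * v k = 0 := by
      rw [← fderiv_F_apply _ ha]
      exact congrFun hv i
    ext j
    have h := sum_F_adjugate_mul_sum_jacobian G a v j
    simp only [hv', mul_zero, Finset.sum_const_zero] at h
    exact (mul_eq_zero.mp h.symm).resolve_left hG
  let A' : (Fin n → ℚ_[p]) ≃L[ℚ_[p]] (Fin n → ℚ_[p]) :=
    ContinuousLinearEquiv.ofBijective A hker (LinearMap.ker_eq_bot_iff_range_eq_top.mp hker)
  have hA' : (A' : (Fin n → ℚ_[p]) →L[ℚ_[p]] (Fin n → ℚ_[p])) = A :=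
    ContinuousLinearEquiv.coe_ofBijective A _ _
  have hstrict : HasStrictFDerivAt Φ (A' : (Fin n → ℚ_[p]) →L[ℚ_[p]] (Fin n → ℚ_[p])) a := by
    rw [hA', ← hA.fderiv]
    exact hΦ.hasStrictFDerivAt
  let e := hstrict.toOpenPartialHomeomorph Φ
  have hae : a ∈ e.source := hstrict.mem_toOpenPartialHomeomorph_source
  refine ⟨e.symm, e.analyticAt_symm' hae hΦ (hA.fderiv.trans hA'.symm), e.left_inv hae, ?_⟩
  exact e.eventually_right_inverse (e.map_source hae)

/-- `ℤ_p` is open in `ℚ_p`, so small moves stay where the exponential converges. -/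
theorem eventually_norm_le_one {X : Type*} [TopologicalSpace X] {f : X → Fin n → ℚ_[p]} {x : X}
    (hf : ContinuousAt f x) (hx : ∀ i, ‖f x i‖ ≤ 1) : ∀ᶠ y in 𝓝 x, ∀ i, ‖f y i‖ ≤ 1 := by
  rw [Filter.eventually_all]
  intro i
  have hopen := IsUltrametricDist.isOpen_closedBall (0 : ℚ_[p]) one_ne_zero
  have hmem : f x i ∈ Metric.closedBall (0 : ℚ_[p]) 1 := by simpa using hx i
  have h := (tendsto_pi_nhds.mp hf i).eventually (hopen.mem_nhds hmem)
  filter_upwards [h] with y hy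
  simpa using hy

/-- Differentiating along the inverse image of a line under a system of exponential
polynomials. -/
theorem det_mul_deriv_F_comp {G : Fin n → MvPolynomial (Fin n ⊕ Fin n) ℤ}
    {γ : ℚ_[p] → Fin n → ℚ_[p]} {t : ℚ_[p]} (hγ : DifferentiableAt ℚ_[p] γ t)
    (hγt : ∀ i, ‖γ t i‖ ≤ 1) {y₀ w : Fin n → ℚ_[p]}
    (hline : ∀ᶠ s in 𝓝 t, (fun i => F p (G i) (γ s)) = y₀ + s • w)
    (R : MvPolynomial (Fin n ⊕ Fin n) ℤ) :
    F p (jacobian p G).det (γ t) * deriv (fun s => F p R (γ s)) t =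
      ∑ l, w l * F p (∑ j, expDeriv p j R * (jacobian p G).adjugate j l) (γ t) := by
  have hderiv (Q : MvPolynomial (Fin n ⊕ Fin n) ℤ) :
      HasDerivAt (fun s => F p Q (γ s)) (∑ j, F p (expDeriv p j Q) (γ t) * deriv γ t j) t := by
    rw [← fderiv_F_apply Q hγt]
    exact (analyticAt_F Q hγt).differentiableAt.hasFDerivAt.comp_hasDerivAt t hγ.hasDerivAt
  have hw (l : Fin n) : ∑ j, F p (expDeriv p j (G l)) (γ t) * deriv γ t j = w l := by
    refine (hderiv (G l)).unique ?_
    have h : HasDerivAt (fun s : ℚ_[p] => y₀ l + s * w l) (w l) t := by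
      simpa using ((hasDerivAt_id t).mul_const (w l)).const_add (y₀ l)
    refine h.congr_of_eventuallyEq ?_
    filter_upwards [hline] with s hs
    simpa using congrFun hs l
  have hcramer (j : Fin n) : F p (jacobian p G).det (γ t) * deriv γ t j =
      ∑ l, F p ((jacobian p G).adjugate j l) (γ t) * w l := by
    have h := sum_F_adjugate_mul_sum_jacobian G (γ t) (deriv γ t) j
    simp only [hw] at h
    exact h.symm
  rw [(hderiv R).deriv, Finset.mul_sum]
  have hterm (j : Fin n) : F p (jacobian p G).det (γ t) *
      (F p (expDeriv p j R) (γ t) * deriv γ t j) = F p (expDeriv p j R) (γ t) *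
        ∑ l, F p ((jacobian p G).adjugate j l) (γ t) * w l := by
    rw [← hcramer, mul_left_comm]
  simp only [hterm, sum_F_expDeriv_mul_adjugate, Finset.mul_sum]
  rw [Finset.sum_comm]
  exact Finset.sum_congr rfl fun l _ => Finset.sum_congr rfl fun j _ => by ring

/-- If `F_P` has a zero in `ℤ_pⁿ`, then it has a zero in `ℤ_pⁿ` at which some system of `n`
exponential polynomials in `n` variables has a nonsingular zero. -/
theorem exists_zero_nonsingular {P : MvPolynomial (Fin n ⊕ Fin n) ℤ} {a : Fin n → ℚ_[p]}
    (ha : ∀ i, ‖a i‖ ≤ 1) (hPa : F p P a = 0) :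
    ∃ (b : Fin n → ℚ_[p]) (Q : Fin n → MvPolynomial (Fin n ⊕ Fin n) ℤ), (∀ i, ‖b i‖ ≤ 1) ∧
      F p P b = 0 ∧ (∀ i, F p (Q i) b = 0) ∧ F p (jacobian p Q).det b ≠ 0 := by
  classical
  obtain ⟨G, S, hdet, hGS, hGX, hspan⟩ := exists_adapted_coordinates ha
  obtain ⟨Ψ, hΨ, hΨa, hinv⟩ := exists_analytic_local_inverse ha hdet
  set y₀ : Fin n → ℚ_[p] := fun i => F p (G i) a with hy₀
  have hΨ1 : ∀ i, ‖Ψ y₀ i‖ ≤ 1 := by rwa [hΨa]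
  have hball := eventually_norm_le_one hΨ.continuousAt hΨ1
  have hF (R : MvPolynomial (Fin n ⊕ Fin n) ℤ) : AnalyticAt ℚ_[p] (fun y => F p R (Ψ y)) y₀ :=
    (analyticAt_F R hΨ1).fun_comp hΨ
  have hdet' : ∀ᶠ y in 𝓝 y₀, F p (jacobian p G).det (Ψ y) ≠ 0 :=
    (hF _).continuousAt.eventually_ne (by rwa [hΨa])
  obtain ⟨q, r, hq⟩ := hF P
  -- `F_P` vanishes on the slice. On each line, vanishing is first known only near `t = 0`, in a
  -- range depending on `w`; the fixed ball of convergence makes it uniform.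
  have hvanish (w : Fin n → ℚ_[p]) (hw : w ∈ Metric.eball (0 : Fin n → ℚ_[p]) r)
      (hwS : ∀ i ∈ S, w i = 0) : F p P (Ψ (y₀ + w)) = 0 := by
    refine hq.eq_zero_of_eventually_eq_zero_on_line hw ?_
    have hline : AnalyticAt ℚ_[p] (fun t : ℚ_[p] => y₀ + t • w) 0 := by fun_prop
    have hline0 : y₀ + (0 : ℚ_[p]) • w = y₀ := by simp
    have htend : Filter.Tendsto (fun t : ℚ_[p] => y₀ + t • w) (𝓝 0) (𝓝 y₀) := by
      simpa [ContinuousAt] using hline.continuousAt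
    have hγ : AnalyticAt ℚ_[p] (fun t : ℚ_[p] => Ψ (y₀ + t • w)) 0 :=
      hΨ.fun_comp_of_eq hline hline0
    refine eventually_eq_zero_of_deriv_mem_span
      (I := {f | ∃ R, F p R a = 0 ∧ f = fun t : ℚ_[p] => F p R (Ψ (y₀ + t • w))})
      (δ := fun t => F p (jacobian p G).det (Ψ (y₀ + t • w))) ?_ ?_ ?_ ?_ ?_ ⟨P, hPa, rfl⟩
    · rintro f ⟨R, -, rfl⟩
      exact (hF R).fun_comp_of_eq hline hline0
    · rintro f ⟨R, hR, rfl⟩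
      simpa [hΨa] using hR
    · exact (hF _).fun_comp_of_eq hline hline0
    · simpa [hΨa] using hdet
    · rintro f ⟨R, hR, rfl⟩
      -- The velocity `w` has no `S`-components, so only tangential derivatives with `l ∉ S` occur,
      -- and these vanish at `a`.
      refine ⟨Fin n, Finset.univ.filter (· ∉ S), w, fun l t =>
        F p (∑ j, expDeriv p j R * (jacobian p G).adjugate j l) (Ψ (y₀ + t • w)), ?_, ?_⟩
      · intro l hl
        exact ⟨_, F_tangential_eq_zero ha (hspan R hR) (Finset.mem_filter.mp hl).2, rfl⟩
      · filter_upwards [hγ.eventually_analyticAt, htend.eventually hball,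
          (htend.eventually hinv).eventually_nhds] with t ht ht1 htinv
        rw [det_mul_deriv_F_comp ht.differentiableAt ht1 htinv R]
        refine (Finset.sum_filter_of_ne (p := (· ∉ S)) fun l _ hl hlS => hl ?_).symm
        rw [hwS l hlS, zero_mul]
  obtain ⟨ε, hε, hεall⟩ := Metric.eventually_nhds_iff.mp
    ((hball.and hinv).and (hdet'.and (Metric.eball_mem_nhds y₀ hq.r_pos)))
  have hc (i : Fin n) : ∃ c : ℤ, i ∉ S → dist (c : ℚ_[p]) (y₀ i) < ε := by
    by_cases hi : i ∈ S
    · exact ⟨0, fun h => absurd hi h⟩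
    · obtain ⟨k, hk⟩ := hGX i hi
      obtain ⟨a', ha'⟩ : ∃ a' : ℤ_[p], (a' : ℚ_[p]) = a k := ⟨⟨a k, ha k⟩, rfl⟩
      obtain ⟨c, hc⟩ := (PadicInt.denseRange_intCast (p := p)).exists_dist_lt a' hε
      refine ⟨c, fun _ => ?_⟩
      rw [dist_eq_norm, PadicInt.norm_def] at hc
      rw [dist_comm]
      simpa [hy₀, hk, F_X_inl, dist_eq_norm, ha'] using hc
  choose c hc using hc
  let y : Fin n → ℚ_[p] := fun i => if i ∈ S then 0 else c i
  have hy : dist y y₀ < ε := by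
    rw [dist_pi_lt_iff hε]
    intro i
    by_cases hi : i ∈ S
    · simpa [y, hi, hy₀, hGS i hi] using hε
    · simpa [y, hi] using hc i hi
  obtain ⟨⟨hy1, hyinv⟩, hydet, hyr⟩ := hεall hy
  refine ⟨Ψ y, fun i => if i ∈ S then G i else G i - C (c i), hy1, ?_, fun i => ?_, ?_⟩
  · have h := hvanish (y - y₀) (by simpa [edist_eq_enorm_sub] using hyr) fun i hi => by
      simp [y, hi, hy₀, hGS i hi]
    rwa [add_sub_cancel] at h
  · have hi := congrFun hyinv i
    by_cases hiS : i ∈ S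
    · simpa [hiS, y] using hi
    · have : F p (G i) (Ψ y) = c i := by simpa [hiS, y] using hi
      simp only [if_neg hiS]
      rw [← evalF_apply, map_sub, evalF_apply, evalF_apply, F_C, this, sub_self]
  -- Subtracting constants does not change the Jacobian.
  · have h : jacobian p (fun i => if i ∈ S then G i else G i - C (c i)) = jacobian p G := by
      ext i j : 1
      by_cases hi : i ∈ S <;> simp [jacobian, hi]
    rwa [h]

end NonsingularSystem

end PadicExp

/-! ### The Jacobian criterion: algebraic independence and local generation of the ideal. -/

section JacobianCriterion

open MvPolynomial

variable {σ ι : Type*} [Fintype ι] [DecidableEq ι]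

/-- The minor of the Jacobian matrix of a system of polynomials belonging to the variables `J`. -/
noncomputable def MvPolynomial.jacobianMinor (R : ι → MvPolynomial σ ℤ) (J : ι → σ) :
    MvPolynomial σ ℤ :=
  (Matrix.of fun i j => pderiv (J j) (R i)).det

/-- Suppose that the polynomials `R i` vanish in a `K`-algebra `B`, and that a minor of their
Jacobian matrix becomes a unit. If all variables not occurring in this minor map to `K`, then
every `K`-derivation of `B` kills the images of all polynomials. -/
theorem Derivation.map_eq_zero_of_isUnit_jacobianMinor [Finite σ] {K B M : Type*} [CommRing K]
    [CommRing B] [Algebra K B] [AddCommGroup M] [Module K M] [Module B M]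
    (D : Derivation K B M) (φ : MvPolynomial σ ℤ →+* B) {R : ι → MvPolynomial σ ℤ}
    (hR : ∀ i, φ (R i) = 0) {J : ι → σ} (hJ : Function.Injective J)
    (hminor : IsUnit (φ (jacobianMinor R J)))
    (hK : ∀ k, k ∉ Set.range J → φ (X k) ∈ Set.range (algebraMap K B))
    (f : MvPolynomial σ ℤ) : D (φ f) = 0 := by
  classical
  have := Fintype.ofFinite σ
  have hchain (f : MvPolynomial σ ℤ) : D (φ f) = ∑ k, φ (pderiv k f) • D (φ (X k)) := by
    induction f using MvPolynomial.induction_on with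
    | C a => simp
    | add f g hf hg => simp [hf, hg, add_smul, Finset.sum_add_distrib]
    | mul_X f k hf =>
      simp only [map_mul, Derivation.leibniz, hf, smul_eq_mul, map_add, add_smul,
        Finset.sum_add_distrib, mul_smul, Finset.smul_sum]
      congr 1
      rw [Finset.sum_eq_single k]
      · simp
      · intro l _ hl
        simp [pderiv_X, hl.symm]
      · simp
  have hchainJ (f : MvPolynomial σ ℤ) : D (φ f) = ∑ j, φ (pderiv (J j) f) • D (φ (X (J j))) := by
    rw [hchain f]
    refine (Fintype.sum_of_injective J hJ _ _ (fun k hk => ?_) fun j => rfl).symm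
    obtain ⟨c, hc⟩ := hK k hk
    rw [← hc, D.map_algebraMap, smul_zero]
  -- Applying `D` to `φ (R i) = 0` gives a homogeneous linear system for the `D (φ (X (J j)))` whose
  -- determinant is a unit.
  have hzero (j : ι) : D (φ (X (J j))) = 0 := by
    let N : Matrix ι ι (MvPolynomial σ ℤ) := Matrix.of fun i j => pderiv (J j) (R i)
    have hrow (i : ι) : ∑ l, φ (N i l) • D (φ (X (J l))) = 0 := by
      rw [← D.map_zero, ← hR i]
      exact (hchainJ (R i)).symm
    have hadj (l : ι) : ∑ i, φ (N.adjugate j i) * φ (N i l) =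
        if j = l then φ (jacobianMinor R J) else 0 := by
      have h := congrArg (fun M => φ (M j l)) (Matrix.adjugate_mul N)
      simp only [Matrix.mul_apply, Matrix.smul_apply, Matrix.one_apply, map_sum, map_mul] at h
      rw [h]
      split_ifs <;> simp [N, jacobianMinor]
    have h : φ (jacobianMinor R J) • D (φ (X (J j))) =
        ∑ i, φ (N.adjugate j i) • ∑ l, φ (N i l) • D (φ (X (J l))) := by
      simp_rw [Finset.smul_sum, smul_smul]
      rw [Finset.sum_comm]
      simp_rw [← Finset.sum_smul, hadj]
      simp
    simp only [hrow, smul_zero, Finset.sum_const_zero] at h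
    exact hminor.smul_eq_zero.mp h
  rw [hchainJ f]
  simp [hzero]

theorem Algebra.FormallyUnramified.of_kaehlerDifferential_D_eq_zero {K B : Type*} [CommRing K]
    [CommRing B] [Algebra K B] (h : ∀ b : B, KaehlerDifferential.D K B b = 0) :
    Algebra.FormallyUnramified K B := by
  refine ⟨(Submodule.subsingleton_iff B).mp (subsingleton_of_bot_eq_top ?_)⟩
  rw [← KaehlerDifferential.span_range_derivation, eq_comm, Submodule.span_eq_bot]
  rintro _ ⟨b, rfl⟩
  exact h b

theorem Algebra.EssFiniteType.of_forall_exists_mul_eq {σ B : Type*} [Finite σ] [CommRing B]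
    (φ : MvPolynomial σ ℤ →+* B) (hφ : ∀ b, ∃ f s, IsUnit (φ s) ∧ b * φ s = φ f) :
    Algebra.EssFiniteType ℤ B := by
  refine (Algebra.essFiniteType_iff ℤ B).mpr
    ⟨(Set.finite_range fun k => φ (X k)).toFinset, fun b => ?_⟩
  have hmem (f : MvPolynomial σ ℤ) :
      φ f ∈ Algebra.adjoin ℤ (Set.range fun k => φ (X k)) := by
    rw [Algebra.adjoin_range_eq_range_aeval]
    exact ⟨f, (AlgHom.congr_fun (aeval_unique φ.toIntAlgHom) f).symm⟩
  obtain ⟨f, s, hs, hfs⟩ := hφ b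
  rw [Set.Finite.coe_toFinset]
  exact ⟨φ s, hmem s, hs, hfs ▸ hmem f⟩

/-- Let `R` be a system of polynomials that vanish at `z`, with nonzero Jacobian minor there. If the
transcendence degree of `ℚ(z)` is at least the number of the remaining variables, then the
coordinates of `z` at those variables are algebraically independent. -/
theorem algebraicIndependent_of_jacobianMinor_ne_zero {τ : Type} {σ : Type*} [Finite σ] [Finite τ]
    {Ω : Type} [Field Ω] [CharZero Ω] {z : σ → Ω}
    (htrdeg : Cardinal.mk τ ≤ Algebra.trdeg ℚ (IntermediateField.adjoin ℚ (Set.range z)))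
    {R : ι → MvPolynomial σ ℤ} (hR : ∀ i, aeval z (R i) = 0) {J : ι → σ}
    (hJ : Function.Injective J) (hminor : aeval z (jacobianMinor R J) ≠ 0) {u : τ → σ}
    (hu : ∀ k, k ∉ Set.range J → k ∈ Set.range u) :
    AlgebraicIndependent ℤ (z ∘ u) := by
  let L := IntermediateField.adjoin ℚ (Set.range z)
  let zL : σ → L := fun k => ⟨z k, IntermediateField.subset_adjoin _ _ ⟨k, rfl⟩⟩
  have hzL (f : MvPolynomial σ ℤ) : ((aeval zL f : L) : Ω) = aeval z f := by
    have : z = algebraMap L Ω ∘ zL := rfl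
    rw [this, aeval_algebraMap_apply]
    rfl
  let K := IntermediateField.adjoin ℚ (Set.range (zL ∘ u))
  have hD (f : MvPolynomial σ ℤ) : KaehlerDifferential.D K L (aeval zL f) = 0 := by
    refine (KaehlerDifferential.D K L).map_eq_zero_of_isUnit_jacobianMinor
      (aeval zL : MvPolynomial σ ℤ →ₐ[ℤ] L).toRingHom (R := R) (fun i => ?_) hJ ?_ (fun k hk => ?_) f
    · exact Subtype.ext ((hzL (R i)).trans (hR i))
    · refine isUnit_iff_ne_zero.mpr fun h => hminor ?_
      rw [← hzL]
      exact congrArg Subtype.val h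
    · obtain ⟨l, rfl⟩ := hu k hk
      exact ⟨⟨zL (u l), IntermediateField.subset_adjoin _ _ ⟨l, rfl⟩⟩, by simp⟩
  have hDall (b : L) : KaehlerDifferential.D K L b = 0 := by
    obtain ⟨b, hb⟩ := b
    induction hb using IntermediateField.adjoin_induction with
    | mem x hx =>
      obtain ⟨k, rfl⟩ := hx
      simpa [zL] using hD (X k)
    | algebraMap q =>
      have : (⟨algebraMap ℚ Ω q, algebraMap_mem _ _⟩ : L) =
        algebraMap K L (algebraMap ℚ K q) := rfl
      rw [this, Derivation.map_algebraMap]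
    | add x y hx hy h1 h2 =>
      have : (⟨x + y, add_mem hx hy⟩ : L) = ⟨x, hx⟩ + ⟨y, hy⟩ := rfl
      rw [this, map_add, h1, h2, add_zero]
    | inv x hx h =>
      have : (⟨x⁻¹, inv_mem hx⟩ : L) = ⟨x, hx⟩⁻¹ := rfl
      rw [this, Derivation.leibniz_inv, h, smul_zero]
    | mul x y hx hy h1 h2 =>
      have : (⟨x * y, mul_mem hx hy⟩ : L) = ⟨x, hx⟩ * ⟨y, hy⟩ := rfl
      rw [this, Derivation.leibniz, h1, h2, smul_zero, smul_zero, add_zero]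
  -- No differentials and finite generation make `L` separable, hence algebraic, over `K`. So the
  -- coordinates `zL ∘ u` contain a transcendence basis, and there are too few of them to omit any.
  have hunr : Algebra.FormallyUnramified K L := .of_kaehlerDifferential_D_eq_zero hDall
  have hfin : Algebra.EssFiniteType ℚ L :=
    IntermediateField.essFiniteType_iff.mpr (IntermediateField.fg_adjoin_of_finite (Set.finite_range z))
  have hfinK : Algebra.EssFiniteType K L := Algebra.EssFiniteType.of_comp ℚ K L
  have hsep : Algebra.IsSeparable K L := Algebra.FormallyUnramified.isSeparable K L
  have halgK : Algebra.IsAlgebraic K L := inferInstance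
  have halg : Algebra.IsAlgebraic (Algebra.adjoin ℚ (Set.range (zL ∘ u))) L := by
    open scoped IntermediateField.algebraAdjoinAdjoin in
    exact (IsFractionRing.comap_isAlgebraic_iff (A := Algebra.adjoin ℚ (Set.range (zL ∘ u)))
      (K := K) (C := L)).mpr halgK
  have hbasis := Algebra.IsAlgebraic.isTranscendenceBasis_of_le_trdeg_of_finite ℚ (zL ∘ u) htrdeg
  have hindep : AlgebraicIndependent ℤ (zL ∘ u) :=
    hbasis.1.restrictScalars (algebraMap ℤ ℚ).injective_int
  exact hindep.map' (f := (L.val.restrictScalars ℤ)) L.val.injective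

/-- Let `B` be a local algebra over a field `K` that is a localization of a quotient of a polynomial
ring over `ℤ`. If the polynomials `R i` vanish in `B`, a minor of their Jacobian matrix becomes a
unit, and the variables not occurring in this minor map to `K`, then `B` is a field. -/
theorem isField_of_isUnit_jacobianMinor {σ K B : Type*} [Finite σ] [Field K] [CommRing B]
    [IsLocalRing B] [Algebra K B] (φ : MvPolynomial σ ℤ →+* B)
    (hφ : ∀ b, ∃ f s, IsUnit (φ s) ∧ b * φ s = φ f)
    {R : ι → MvPolynomial σ ℤ} (hR : ∀ i, φ (R i) = 0) {J : ι → σ} (hJ : Function.Injective J)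
    (hminor : IsUnit (φ (jacobianMinor R J)))
    (hK : ∀ k, k ∉ Set.range J → φ (X k) ∈ Set.range (algebraMap K B)) : IsField B := by
  have hD (b : B) : KaehlerDifferential.D K B b = 0 := by
    have hDφ := (KaehlerDifferential.D K B).map_eq_zero_of_isUnit_jacobianMinor φ hR hJ hminor hK
    obtain ⟨f, s, hs, hfs⟩ := hφ b
    have h := hDφ f
    rw [← hfs, Derivation.leibniz, hDφ, smul_zero, zero_add] at h
    exact hs.smul_eq_zero.mp h
  have : Algebra.FormallyUnramified K B := .of_kaehlerDifferential_D_eq_zero hD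
  -- Unramified and essentially of finite type over a field means reduced and finite; a reduced
  -- Artinian local ring is a field.
  have : Algebra.EssFiniteType ℤ B := .of_forall_exists_mul_eq φ hφ
  have : Algebra.EssFiniteType K B := .of_comp ℤ K B
  have : IsReduced B := Algebra.FormallyUnramified.isReduced_of_field K B
  have : Module.Finite K B := Algebra.FormallyUnramified.finite_of_free K B
  have : IsArtinianRing B := isArtinian_of_tower K inferInstance
  exact IsArtinianRing.isField_of_isReduced_of_isLocalRing B

/-- Let `B` be a local ring that is a localization of a quotient of a polynomial ring over `ℤ`. If
the polynomials `R i` vanish in `B`, a minor of their Jacobian matrix becomes a unit, and so do all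
nonzero polynomials in the remaining variables, then `B` is a field. -/
theorem isField_of_isUnit_jacobianMinor_of_isUnit_rename {σ τ B : Type*} [Finite σ] [CommRing B]
    [IsLocalRing B] (φ : MvPolynomial σ ℤ →+* B)
    (hφ : ∀ b, ∃ f s, IsUnit (φ s) ∧ b * φ s = φ f)
    {R : ι → MvPolynomial σ ℤ} (hR : ∀ i, φ (R i) = 0) {J : ι → σ} (hJ : Function.Injective J)
    (hminor : IsUnit (φ (jacobianMinor R J))) {u : τ → σ}
    (hu : ∀ k, k ∉ Set.range J → k ∈ Set.range u)
    (hind : ∀ f : MvPolynomial τ ℤ, f ≠ 0 → IsUnit (φ (rename u f))) : IsField B := by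
  let ψ : MvPolynomial τ ℤ →+* B := φ.comp (rename u).toRingHom
  have hψ (s : nonZeroDivisors (MvPolynomial τ ℤ)) : IsUnit (ψ s) :=
    hind s (nonZeroDivisors.coe_ne_zero s)
  -- The rational function field in the remaining variables maps to `B` and serves as the base field
  -- `K`.
  let ρ : FractionRing (MvPolynomial τ ℤ) →+* B := IsLocalization.lift hψ
  let _ : Algebra (FractionRing (MvPolynomial τ ℤ)) B := ρ.toAlgebra
  refine isField_of_isUnit_jacobianMinor (K := FractionRing (MvPolynomial τ ℤ)) φ hφ hR hJ hminor
    fun k hk => ?_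
  obtain ⟨l, rfl⟩ := hu k hk
  refine ⟨algebraMap (MvPolynomial τ ℤ) _ (X l), (IsLocalization.lift_eq hψ (X l)).trans ?_⟩
  simp [ψ]

/-- Let `R` be a system of polynomials that vanish at `z`, with a nonzero Jacobian minor there. If
the coordinates of `z` at the remaining variables are algebraically independent, then `R` generates
locally at `z` the ideal of all polynomials that vanish at `z`. -/
theorem exists_mul_eq_sum_of_jacobianMinor_ne_zero {σ τ Ω : Type*} [Finite σ] [Field Ω]
    {z : σ → Ω} {R : ι → MvPolynomial σ ℤ} (hR : ∀ i, aeval z (R i) = 0) {J : ι → σ}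
    (hJ : Function.Injective J) (hminor : aeval z (jacobianMinor R J) ≠ 0) {u : τ → σ}
    (hu : ∀ k, k ∉ Set.range J → k ∈ Set.range u) (hind : AlgebraicIndependent ℤ (z ∘ u))
    {P : MvPolynomial σ ℤ} (hP : aeval z P = 0) :
    ∃ (Q : MvPolynomial σ ℤ) (S : ι → MvPolynomial σ ℤ),
      aeval z Q ≠ 0 ∧ Q * P = ∑ i, R i * S i := by
  let I : Ideal (MvPolynomial σ ℤ) := RingHom.ker (aeval z : MvPolynomial σ ℤ →ₐ[ℤ] Ω)
  have hI (f : MvPolynomial σ ℤ) : f ∈ I ↔ aeval z f = 0 := RingHom.mem_ker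
  have : I.IsPrime := RingHom.ker_isPrime _
  let A := Localization.AtPrime I
  let 𝔞 : Ideal A := (Ideal.span (Set.range R)).map (algebraMap (MvPolynomial σ ℤ) A)
  let B := A ⧸ 𝔞
  let φ : MvPolynomial σ ℤ →+* B := (Ideal.Quotient.mk 𝔞).comp (algebraMap (MvPolynomial σ ℤ) A)
  have hφR (i : ι) : φ (R i) = 0 :=
    Ideal.Quotient.eq_zero_iff_mem.mpr (Ideal.mem_map_of_mem _ (Ideal.subset_span ⟨i, rfl⟩))
  have hφunit {f : MvPolynomial σ ℤ} (hf : aeval z f ≠ 0) : IsUnit (φ f) :=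
    (IsLocalization.map_units A (⟨f, fun h => hf ((hI f).mp h)⟩ : I.primeCompl)).map
      (Ideal.Quotient.mk 𝔞)
  let ε : A →+* Ω := IsLocalization.lift (M := I.primeCompl)
    (g := (aeval z : MvPolynomial σ ℤ →ₐ[ℤ] Ω).toRingHom)
    fun s => isUnit_iff_ne_zero.mpr fun h => s.2 ((hI s).mpr h)
  have hε (f : MvPolynomial σ ℤ) : ε (algebraMap _ A f) = aeval z f := IsLocalization.lift_eq _ f
  -- Evaluation at `z` factors through `B`, which shows that `B` is nontrivial and that `φ P`,
  -- evaluating to `0`, is not a unit.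
  let θ : B →+* Ω := Ideal.Quotient.lift 𝔞 ε fun x hx => by
    have : 𝔞 ≤ RingHom.ker ε := by
      rw [Ideal.map_le_iff_le_comap, Ideal.span_le]
      rintro _ ⟨i, rfl⟩
      exact (hε (R i)).trans (hR i)
    exact this hx
  have hθ (f : MvPolynomial σ ℤ) : θ (φ f) = aeval z f := hε f
  have : Nontrivial B := θ.domain_nontrivial
  have : IsLocalRing B := .of_surjective' (Ideal.Quotient.mk 𝔞) Ideal.Quotient.mk_surjective
  have hfield : IsField B := by
    refine isField_of_isUnit_jacobianMinor_of_isUnit_rename (B := B) φ (fun b => ?_) hφR hJ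
      (hφunit hminor) hu
      fun f hf => ?_
    · obtain ⟨x, rfl⟩ := Ideal.Quotient.mk_surjective b
      obtain ⟨⟨f, s⟩, hfs⟩ := IsLocalization.surj I.primeCompl x
      refine ⟨f, s, hφunit fun h => s.2 ((hI s).mpr h), ?_⟩
      rw [RingHom.comp_apply, RingHom.comp_apply, ← map_mul, hfs]
    · refine hφunit fun h => hf (hind.eq_zero_of_aeval_eq_zero _ ?_)
      rwa [← aeval_rename]
  have hφP : φ P = 0 := by
    by_contra hne
    obtain ⟨c, hc⟩ := hfield.mul_inv_cancel hne
    have := congrArg θ hc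
    rw [map_mul, hθ, hP, zero_mul, map_one] at this
    exact zero_ne_one this
  have hmem : algebraMap _ A P ∈ 𝔞 := Ideal.Quotient.eq_zero_iff_mem.mp hφP
  -- Two denominators are cleared: `s` from membership in the extended ideal, `t` from an equality
  -- in the localization. Their product is `Q`.
  obtain ⟨⟨⟨r, hr⟩, s⟩, hs⟩ := (IsLocalization.mem_map_algebraMap_iff I.primeCompl A).mp hmem
  rw [← map_mul] at hs
  obtain ⟨t, ht⟩ := (IsLocalization.eq_iff_exists I.primeCompl A).mp hs
  obtain ⟨c, hc⟩ := Ideal.mem_span_range_iff_exists_fun.mp hr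
  subst hc
  refine ⟨t * s, fun i => t * c i, fun h => ?_, ?_⟩
  · exact (t * s).2 ((hI _).mpr h)
  · rw [mul_assoc, mul_comm (s : MvPolynomial σ ℤ) P, ht, Finset.mul_sum]
    exact Finset.sum_congr rfl fun i _ => by ring

/-- Let `φ` be a point of affine space with coordinates in a field, and `R` a system of polynomials
that vanish there, with a nonzero Jacobian minor. If the transcendence degree of the field generated
by the coordinates of `φ` is at least the number of the remaining variables, then `R` generates
locally at `φ` the ideal of all polynomials that vanish at `φ`. -/
theorem exists_mul_eq_sum_of_le_trdeg {τ Ω : Type} {σ : Type*} [Finite σ] [Finite τ] [Field Ω]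
    [CharZero Ω] (φ : MvPolynomial σ ℤ →+* Ω)
    (htrdeg : Cardinal.mk τ ≤
      Algebra.trdeg ℚ (IntermediateField.adjoin ℚ (Set.range fun k => φ (X k))))
    {R : ι → MvPolynomial σ ℤ} (hR : ∀ i, φ (R i) = 0) {J : ι → σ}
    (hJ : Function.Injective J) (hminor : φ (jacobianMinor R J) ≠ 0) {u : τ → σ}
    (hu : ∀ k, k ∉ Set.range J → k ∈ Set.range u) {P : MvPolynomial σ ℤ} (hP : φ P = 0) :
    ∃ (Q : MvPolynomial σ ℤ) (S : ι → MvPolynomial σ ℤ),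
      φ Q ≠ 0 ∧ Q * P = ∑ i, R i * S i := by
  have hφ (f : MvPolynomial σ ℤ) : φ f = aeval (fun k => φ (X k)) f :=
    AlgHom.congr_fun (aeval_unique φ.toIntAlgHom) f
  simp only [hφ (R _), hφ (jacobianMinor R J), hφ P] at hR hminor hP
  obtain ⟨Q, S, hQ, h⟩ := exists_mul_eq_sum_of_jacobianMinor_ne_zero hR hJ hminor hu
    (algebraicIndependent_of_jacobianMinor_ne_zero htrdeg hR hJ hminor hu) hP
  exact ⟨Q, S, by rwa [hφ], h⟩

/-- If a matrix `A + B D` with `D` diagonal is invertible, so is some matrix each column of which is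
the corresponding column of `A` or of `B`. -/
theorem Matrix.exists_det_ne_zero_of_det_add_mul_ne_zero {k : Type*} [CommRing k]
    {A B : Matrix ι ι k} {v : ι → k} (h : (Matrix.of fun i j => A i j + v j * B i j).det ≠ 0) :
    ∃ s : Finset ι, (Matrix.of fun i j => if j ∈ s then A i j else B i j).det ≠ 0 := by
  by_contra! hall
  refine h ?_
  rw [← Matrix.det_transpose]
  -- Expands the determinant over all choices of one summand per column; the factors `v j` then come
  -- out of each term.
  have hsum := (Matrix.detRowAlternating (n := ι) (R := k)).map_add_univ
    (fun j i => A i j) (fun j i => v j * B i j)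
  refine hsum.trans (Finset.sum_eq_zero fun s _ => ?_)
  have hdet := Matrix.det_mul_column (fun j => if j ∈ s then 1 else v j)
    (Matrix.of fun j i => if j ∈ s then A i j else B i j)
  rw [← Matrix.det_transpose (Matrix.of fun j i => if j ∈ s then A i j else B i j)] at hdet
  rw [show (Matrix.of fun j i => if j ∈ s then A i j else B i j).transpose =
    Matrix.of fun i j => if j ∈ s then A i j else B i j from rfl, hall s, mul_zero] at hdet
  refine Eq.trans (congrArg Matrix.det ?_) hdet
  ext j i
  by_cases hj : j ∈ s <;> simp [hj]

end JacobianCriterion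

/-! ### Application at the point `(b, E_p b)`. -/

namespace PadicExp

open MvPolynomial

variable {p n : ℕ} [hp : Fact p.Prime]

/-- Evaluation of polynomials at the point `(b, E_p b)` of `ℂ_p²ⁿ`. -/
noncomputable def graphEval (b : Fin n → ℚ_[p]) : MvPolynomial (Fin n ⊕ Fin n) ℤ →+* ℂ_[p] :=
  (algebraMap ℚ_[p] ℂ_[p]).comp (evalF p b).toRingHom

theorem graphEval_eq_zero_iff (b : Fin n → ℚ_[p]) (f : MvPolynomial (Fin n ⊕ Fin n) ℤ) :
    graphEval b f = 0 ↔ F p f b = 0 :=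
  map_eq_zero_iff _ (algebraMap ℚ_[p] ℂ_[p]).injective

theorem graphEval_X_inl (b : Fin n → ℚ_[p]) (i : Fin n) :
    graphEval b (X (Sum.inl i)) = algebraMap ℚ_[p] ℂ_[p] (b i) := by
  simp [graphEval, evalF]

theorem graphEval_X_inr (b : Fin n → ℚ_[p]) (i : Fin n) :
    graphEval b (X (Sum.inr i)) = algebraMap ℚ_[p] ℂ_[p] (E p (b i)) := by
  simp [graphEval, evalF]

/-- The conjecture is applied to `expFactor p · b i`; a nonzero rational factor affects neither
linear independence nor the generated field. -/
theorem SchanuelConjecture.le_trdeg (hS : SchanuelConjecture p) (hn : 1 ≤ n) {b : Fin n → ℚ_[p]}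
    (hb : ∀ i, ‖b i‖ ≤ 1) (hind : LinearIndependent ℚ b) :
    (n : Cardinal) ≤
      Algebra.trdeg ℚ (IntermediateField.adjoin ℚ (Set.range fun k => graphEval b (X k))) := by
  let t : Fin n → ℂ_[p] := fun i => algebraMap ℚ_[p] ℂ_[p] ((expFactor p : ℚ_[p]) * b i)
  let T : ℚ_[p] →ₗ[ℚ] ℂ_[p] :=
    (algebraMap ℚ_[p] ℂ_[p]).toRatAlgHom.toLinearMap.comp
      (LinearMap.mulLeft ℚ (expFactor p : ℚ_[p]))
  have hT : LinearMap.ker T = ⊥ := by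
    rw [LinearMap.ker_eq_bot']
    intro x hx
    have h : (expFactor p : ℚ_[p]) * x = 0 :=
      (map_eq_zero_iff _ (algebraMap ℚ_[p] ℂ_[p]).injective).mp hx
    exact (mul_eq_zero.mp h).resolve_left expFactor_ne_zero
  have ht : LinearIndependent ℚ t := hind.map' T hT
  have htnorm (i : Fin n) : ‖t i‖ < (p : ℝ) ^ (-(1 / ((p : ℝ) - 1))) := by
    rw [norm_algebraMap']
    exact norm_expFactor_mul_lt (hb i)
  have hexp (i : Fin n) : NormedSpace.exp (t i) = graphEval b (X (Sum.inr i)) :=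
    (algebraMap_E (hb i)).symm.trans (graphEval_X_inr b i).symm
  have hti (i : Fin n) : t i = (expFactor p : ℂ_[p]) * graphEval b (X (Sum.inl i)) := by
    simp [t, graphEval_X_inl]
  have hc : (expFactor p : ℂ_[p]) ≠ 0 := by
    have h := expFactor_ne_zero (p := p)
    rw [Nat.cast_ne_zero] at h ⊢
    exact h
  have hadj : IntermediateField.adjoin ℚ (Set.range t ∪ Set.range fun i => NormedSpace.exp (t i)) =
      IntermediateField.adjoin ℚ (Set.range fun k => graphEval b (X k)) := by
    apply le_antisymm <;> rw [IntermediateField.adjoin_le_iff]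
    · rintro _ (⟨i, rfl⟩ | ⟨i, rfl⟩)
      · rw [hti]
        exact mul_mem (natCast_mem _ _) (IntermediateField.subset_adjoin _ _ ⟨_, rfl⟩)
      · exact IntermediateField.subset_adjoin _ _ ⟨Sum.inr i, (hexp i).symm⟩
    · rintro _ ⟨i | i, rfl⟩
      · beta_reduce
        rw [← inv_mul_cancel_left₀ hc (graphEval b (X (Sum.inl i))), ← hti]
        exact mul_mem (inv_mem (natCast_mem _ _))
          (IntermediateField.subset_adjoin _ _ (Or.inl ⟨i, rfl⟩))
      · exact IntermediateField.subset_adjoin _ _ (Or.inr ⟨i, hexp i⟩)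
  rw [← hadj]
  exact hS n hn t ht htnorm

/-- A nonvanishing functional determinant of exponential polynomials forces some minor of the
Jacobian matrix of the underlying polynomials not to vanish. -/
theorem exists_jacobianMinor_ne_zero {b : Fin n → ℚ_[p]}
    {R : Fin n → MvPolynomial (Fin n ⊕ Fin n) ℤ} (h : F p (jacobian p R).det b ≠ 0) :
    ∃ s : Finset (Fin n), F p (jacobianMinor R fun j =>
      if j ∈ s then Sum.inl j else Sum.inr j) b ≠ 0 := by
  have hdet : F p (jacobian p R).det b = (Matrix.of fun i j =>
      F p (pderiv (Sum.inl j) (R i)) b + ((expFactor p : ℚ_[p]) * E p (b j)) *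
        F p (pderiv (Sum.inr j) (R i)) b).det := by
    rw [← evalF_apply, AlgHom.map_det]
    congr 1
    ext i j
    simp [jacobian, expDeriv, evalF, F]
  rw [hdet] at h
  obtain ⟨s, hs⟩ := Matrix.exists_det_ne_zero_of_det_add_mul_ne_zero
    (A := Matrix.of fun i j => F p (pderiv (Sum.inl j) (R i)) b)
    (B := Matrix.of fun i j => F p (pderiv (Sum.inr j) (R i)) b) h
  refine ⟨s, ?_⟩
  rw [← evalF_apply, jacobianMinor, AlgHom.map_det]
  convert hs using 2
  ext i j
  by_cases hj : j ∈ s <;> simp [hj, evalF_apply]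

end PadicExp

theorem mainTheorem6 (p : ℕ) [Fact p.Prime] (hSchanuel : PadicExp.SchanuelConjecture p)
    (n : ℕ) (hn : 1 ≤ n) (P : MvPolynomial (Fin n ⊕ Fin n) ℤ)
    (hzero : ∃ a : Fin n → ℤ_[p], PadicExp.F p P (fun i => (a i : ℚ_[p])) = 0)
    (hindep : ∀ a : Fin n → ℤ_[p], PadicExp.F p P (fun i => (a i : ℚ_[p])) = 0 →
      LinearIndependent ℚ (fun i => (a i : ℚ_[p]))) :
    ∃ (b : Fin n → ℤ_[p]) (Q : MvPolynomial (Fin n ⊕ Fin n) ℤ)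
      (Qs Ss : Fin n → MvPolynomial (Fin n ⊕ Fin n) ℤ),
      PadicExp.F p P (fun i => (b i : ℚ_[p])) = 0 ∧
      PadicExp.IsNonsingularZero p (fun i => PadicExp.F p (Qs i)) (fun i => (b i : ℚ_[p])) ∧
      PadicExp.F p Q (fun i => (b i : ℚ_[p])) ≠ 0 ∧
      Q * P = ∑ i, Qs i * Ss i := by
  obtain ⟨a, ha⟩ := hzero
  obtain ⟨b, R, hb, hPb, hRb, hdet⟩ :=
    PadicExp.exists_zero_nonsingular (fun i => (a i).norm_le_one) ha
  obtain ⟨b, rfl⟩ : ∃ b' : Fin n → ℤ_[p], b = fun i => (b' i : ℚ_[p]) :=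
    ⟨fun i => ⟨b i, hb i⟩, rfl⟩
  -- Linear independence is needed at the new zero `b`, which is why it is assumed at every zero.
  have htrdeg := hSchanuel.le_trdeg hn hb (hindep b hPb)
  obtain ⟨s, hs⟩ := PadicExp.exists_jacobianMinor_ne_zero hdet
  -- For each `j` the minor uses one of the variables `x_j`, `y_j`; the other one is among the
  -- remaining `n` variables.
  have hJ : Function.Injective fun j : Fin n =>
      if j ∈ s then (Sum.inl j : Fin n ⊕ Fin n) else Sum.inr j := by
    intro i j hij
    by_cases hi : i ∈ s <;> by_cases hj : j ∈ s <;> simp_all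
  have hu (k : Fin n ⊕ Fin n) (hk : k ∉ Set.range fun j : Fin n =>
      if j ∈ s then (Sum.inl j : Fin n ⊕ Fin n) else Sum.inr j) :
      k ∈ Set.range fun j : Fin n => if j ∈ s then (Sum.inr j : Fin n ⊕ Fin n) else Sum.inl j := by
    rcases k with j | j
    · refine ⟨j, if_neg fun hj => hk ⟨j, if_pos hj⟩⟩
    · refine ⟨j, if_pos (by_contra fun hj => hk ⟨j, if_neg hj⟩)⟩
  obtain ⟨Q, S, hQ, hQP⟩ := exists_mul_eq_sum_of_le_trdeg (PadicExp.graphEval _)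
    ((Cardinal.mk_fin n).trans_le htrdeg)
    (fun i => (PadicExp.graphEval_eq_zero_iff _ _).mpr (hRb i)) hJ
    ((PadicExp.graphEval_eq_zero_iff _ _).not.mpr hs) hu
    ((PadicExp.graphEval_eq_zero_iff _ _).mpr hPb)
  exact ⟨b, Q, R, S, hPb, ⟨hRb, (PadicExp.linearIndependent_fderiv_F_iff R hb).mpr hdet⟩,
    (PadicExp.graphEval_eq_zero_iff _ _).not.mp hQ, hQP⟩
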